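/- **Setting.** A weighted point set in $\mathbb R^d$ is a finite set of points with nonnegative weights. For weighted point sets $P,Q$ of equal total weight let $\mathcal W(P,Q)=\min_F\big(\sum_{p,q}f_{pq}\|p-q\|^2\big)^{1/2}$ over all flows $f\ge 0$ with marginals $P$ and $Q$. If $Q$ has total weight $z$ less than $P$, let $\mathcal W_{-z}(P,Q)=\min_{P'}\mathcal W(P',Q)$ over all $P'$ with $0\le w_{P'}\le w_P$ pointwise and of total weight $w_P(P)-z$. Let $\mathbb P=\{P_1,\dots,P_m\}$, $m\ge1$, be weighted point sets with positive weights, each of total weight $n$, let $0\le z<n$, $k\ge 1$, and for $S$ of total weight $n-z$ put $\mathrm{Cost}_{-z}(\mathbb P,S)=\frac1m\sum_j\mathcal W_{-z}^2(P_j,S)$. Let $S_{\mathrm{opt}}$ minimise $\mathrm{Cost}_{-z}(\mathbb P,\cdot)$ among the weighted sets of total weight $n-z$ carried by $k$ points (weights may be zero, so at most $k$ points have positive weight). Normalise the input so that any two distinct points of $\bigcup_j P_j$ have distance in $[1,\Delta]$ and every weight is at least $1/n$. Put $w_{\min}=\min_{j,\,p\in P_j}w_{P_j}(p)$ and $\hat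 z=\lceil z/w_{\min}\rceil$; $\log$ is to base $2$. Let $0<\varepsilon\le 1$ and $\varepsilon_1=\varepsilon_2=\varepsilon/16$. **Algorithm.** (0) For each $j$ let $T_j=\{t_1,\dots,t_{\lambda(k+\hat z)}\}$, with an integer $\lambda\ge1$, be the centres returned by an $\alpha$-approximate ($\alpha\ge1$, possibly bi-criteria) $(k+\hat z)$-means algorithm, i.e. $\sum_{p\in P_j}w_{P_j}(p)\min_s\|p-t_s\|^2$ is at most $\alpha$ times the optimal $(k+\hat z)$-means cost of $P_j$. Assign every point of $P_j$ to a nearest centre (ties arbitrary), and give each centre the total weight of its cluster. (1) *Anchor points.* Let $\bar r_j=\sqrt{\mathcal W^2(P_j,T_j)/n}$. Around each $t_s$ take the layers $B(t_s,\bar r_j)$ and $B(t_s,2^h\bar r_j)\setminus B(t_s,2^{h-1}\bar r_j)$, $1\le h\le\lceil\log n\rceil$; for the $h$-th layer ($0\le h\le\lceil\log n\rceil$) take the grid of side length $\bar r_j\varepsilon_12^{h-1}/\sqrt{\alpha d}$ in the ball $B(t_s,2^h\bar r_j)$, aligned with $t_s$. Move every point of $P_j$ in the cluster of $t_s$ to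 a nearest point of the grid of the layer around $t_s$ in which it lies (ties arbitrary). This gives the weighted set $\hat T_j$; its points, the anchor points, are grid points, among them all those of positive weight (grid points of weight zero may be kept or dropped). (2) *Support.* For each anchor point $q\in\bigcup_j\hat T_j$ and each $h=0,\dots,\lceil\log\Delta\rceil$ take the grid of side length $\varepsilon_22^{h-1}/\sqrt d$ in the ball $B(q,2^h)$, aligned with $q$. Let $\bar G$ be the union of all these grids. (3) Let $\tilde G$ solve the fixed-support barycenter problem with $z$ outliers on $\bar G$, i.e. $\tilde G$ minimises $\mathrm{Cost}_{-z}(\mathbb P,\cdot)$ among all weighted sets of total weight $n-z$ supported in $\bar G$; or let $\tilde G$ solve that problem for the instance $\mathbb T=\{\hat T_1,\dots,\hat T_m\}$ instead of $\mathbb P$. **Theorem.** In both cases, and for every choice left open above, $$\mathrm{Cost}_{-z}(\mathbb P,\tilde G)\le(1+\varepsilon)\,\mathrm{Cost}_{-z}(\mathbb P,S_{\mathrm{opt}}).$$ -/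

import Mathlib

open scoped NNReal

noncomputable section

namespace WB

/-- `d`-dimensional Euclidean space. -/
abbrev Pt (d : ℕ) : Type := EuclideanSpace ℝ (Fin d)

/-- A finite weighted point set in `ℝ^d`: a finitely supported nonnegative weight function. -/
abbrev WSet (d : ℕ) : Type := Pt d →₀ ℝ≥0

/-- The total weight of a weighted point set. -/
def total {d : ℕ} (P : WSet d) : ℝ := ∑ p ∈ P.support, (P p : ℝ)

/-- `f p q` is the amount of weight moved from `p` to `q`; both marginals are prescribed. -/
structure IsFlow {d : ℕ} (P Q : WSet d) (f : Pt d → Pt d → ℝ) : Prop where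
  nonneg : ∀ p ∈ P.support, ∀ q ∈ Q.support, 0 ≤ f p q
  out : ∀ p ∈ P.support, ∑ q ∈ Q.support, f p q = P p
  into : ∀ q ∈ Q.support, ∑ p ∈ P.support, f p q = Q q

/-- The quadratic transportation cost of a flow. -/
def flowCost {d : ℕ} (P Q : WSet d) (f : Pt d → Pt d → ℝ) : ℝ :=
  ∑ p ∈ P.support, ∑ q ∈ Q.support, f p q * dist p q ^ 2

/-- The 2-Wasserstein distance between weighted point sets of equal total weight. -/
def wass {d : ℕ} (P Q : WSet d) : ℝ :=
  sInf ((fun f => √(flowCost P Q f)) '' {f | IsFlow P Q f})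

/-- The weighted point sets obtained from `P` by discarding weight `z`. -/
def inlierSets {d : ℕ} (z : ℝ) (P : WSet d) : Set (WSet d) :=
  {P' | (∀ p, P' p ≤ P p) ∧ total P' = total P - z}

/-- The Wasserstein distance with `z` outliers from `P` to `Q` (with `total Q = total P - z`). -/
def wassOut {d : ℕ} (z : ℝ) (P Q : WSet d) : ℝ :=
  sInf ((fun P' => wass P' Q) '' inlierSets z P)

/-- The barycenter cost with `z` outliers. -/
def cost {d m : ℕ} (z : ℝ) (P : Fin m → WSet d) (S : WSet d) : ℝ :=
  (1 / (m : ℝ)) * ∑ j, wassOut z (P j) S ^ 2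

/-- Candidates for the `k`-sparse barycenter with `z` outliers: total weight `n - z`, carried by
`k` points (a carrier point may have weight zero, so at most `k` points have positive weight). -/
def IsSparse {d : ℕ} (n z : ℝ) (k : ℕ) (S : WSet d) : Prop :=
  total S = n - z ∧ S.support.card ≤ k

/-- `S` is an optimal `k`-sparse barycenter with `z` outliers. -/
def IsOptSparse {d m : ℕ} (n z : ℝ) (k : ℕ) (P : Fin m → WSet d) (S : WSet d) : Prop :=
  IsSparse n z k S ∧ ∀ S' : WSet d, IsSparse n z k S' → cost z P S ≤ cost z P S'

/-- `S` solves the fixed-support barycenter problem with `z` outliers on the support `G`. -/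
def IsOptFixedSupport {d m : ℕ} (n z : ℝ) (G : Set (Pt d)) (P : Fin m → WSet d)
    (S : WSet d) : Prop :=
  (total S = n - z ∧ ↑S.support ⊆ G) ∧
    ∀ S' : WSet d, total S' = n - z → ↑S'.support ⊆ G → cost z P S ≤ cost z P S'

/-- The `K`-means cost of `P` with respect to the centres `C`. -/
def kmeansCost {d K : ℕ} (P : WSet d) (C : Fin K → Pt d) : ℝ :=
  ∑ p ∈ P.support, (P p : ℝ) * ⨅ s, dist p (C s) ^ 2

/-- The optimal `K`-means cost of `P`. -/
def kmeansOpt {d : ℕ} (K : ℕ) (P : WSet d) : ℝ :=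
  ⨅ C : Fin K → Pt d, kmeansCost P C

/-- The smallest weight of a point of an instance. -/
def minWeight {d m : ℕ} (P : Fin m → WSet d) : ℝ :=
  sInf {w : ℝ | ∃ j, ∃ p ∈ (P j).support, w = P j p}

/-- The grid of side length `a` inside the ball of radius `r` around `c`, aligned with `c`. -/
def ballGrid {d : ℕ} (c : Pt d) (r a : ℝ) : Set (Pt d) :=
  {x | (∃ v : Fin d → ℤ, ∀ i, x i = c i + a * v i) ∧ x ∈ Metric.closedBall c r}

/-- The layers of the balls around `c` with radii `r, 2r, 4r, …`. -/
def layer {d : ℕ} (c : Pt d) (r : ℝ) : ℕ → Set (Pt d)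
  | 0 => Metric.closedBall c r
  | h + 1 => Metric.closedBall c (r * 2 ^ (h + 1)) \ Metric.closedBall c (r * 2 ^ h)

/-- The grid built for the `h`-th layer around `c`, of side length `r ε₁ 2^(h-1) / √(α d)`. -/
def layerGrid {d : ℕ} (α ε₁ : ℝ) (c : Pt d) (r : ℝ) (h : ℕ) : Set (Pt d) :=
  ballGrid c (r * 2 ^ h) (r * ε₁ * (2 ^ h / 2) / √(α * d))

/-- `g` is a nearest point of `G` to `p`. -/
def IsNearest {d : ℕ} (G : Set (Pt d)) (p g : Pt d) : Prop :=
  g ∈ G ∧ ∀ g' ∈ G, dist p g ≤ dist p g'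

/-- The points of `P` collected at the centres `T` by the clustering `σ`: each centre gets the
total weight of its cluster. -/
def centreSet {d K : ℕ} (P : WSet d) (T : Fin K → Pt d) (σ : Pt d → Fin K) : WSet d :=
  P.mapDomain (fun p => T (σ p))

/-- The radius `√(𝒲²(P, T) / n)` of the innermost layer. -/
def baseRadius {d K : ℕ} (n : ℝ) (P : WSet d) (T : Fin K → Pt d) (σ : Pt d → Fin K) : ℝ :=
  √(wass P (centreSet P T σ) ^ 2 / n)

/-- `(That, A)` is an outcome of the anchor construction for the point set `P` of total weight `n`
and the centres `T`. Every point of `P` belongs to the cluster of a nearest centre (map `σ`) and is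
moved to a nearest point (map `g`) of the grid of the layer, around that centre, in which it lies;
`That` is the resulting weighted set. `A` is the set of anchor points: grid points, among them all
those of positive weight in `That` (grid points of weight zero may be kept or dropped). -/
def IsAnchorSet {d K : ℕ} (α ε₁ n : ℝ) (P : WSet d) (T : Fin K → Pt d) (That : WSet d)
    (A : Set (Pt d)) : Prop :=
  ∃ (σ : Pt d → Fin K) (g : Pt d → Pt d),
    (∀ p ∈ P.support, ∀ s, dist p (T (σ p)) ≤ dist p (T s)) ∧
    (∀ p ∈ P.support, ∀ h ≤ ⌈Real.logb 2 n⌉₊,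
      p ∈ layer (T (σ p)) (baseRadius n P T σ) h →
        IsNearest (layerGrid α ε₁ (T (σ p)) (baseRadius n P T σ) h) p (g p)) ∧
    That = P.mapDomain g ∧
    ↑That.support ⊆ A ∧
    A ⊆ ⋃ s : Fin K, ⋃ h ∈ Set.Iic ⌈Real.logb 2 n⌉₊,
      layerGrid α ε₁ (T s) (baseRadius n P T σ) h

/-- The union of the grids of side lengths `ε₂ 2^(h-1) / √d` in the balls of radii `2^h`,
`0 ≤ h ≤ ⌈log₂ Δ⌉`, around all points of `A`. -/
def supportGrid {d : ℕ} (ε₂ Δ : ℝ) (A : Set (Pt d)) : Set (Pt d) :=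
  ⋃ q ∈ A, ⋃ h ∈ Set.Iic ⌈Real.logb 2 Δ⌉₊, ballGrid q (2 ^ h) (ε₂ * (2 ^ h / 2) / √d)

end WB

end

noncomputable section

namespace WB

variable {d : ℕ}

/-! Choosing the inliers and the flow at once turns `𝒲_{-z}²` into an infimum over partial plans,
which can be transported along maps of the source or the target. Take near-optimal plans from the
inputs to `Sopt`, of total cost `F`.

Anchors are cheap. Rounding within layers costs on average `O(ε₁²/α)` times the squared distance to
the centre (`moveCost_anchor_le`). Moreover `k + ẑ` centres do no worse than `k` centres with
outliers: spend the extra ones on the points farthest from `Sopt`, which weigh at least `z` or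
exhaust the input (`kmeansOpt_le_flowCost`). So the total anchor move `B` is `O(ε² F)`.

The grid is fine enough. A location of `Sopt` receives masses from all inputs, and only the distance
from their centroid to the grid matters. If their variance is small, unit separation forces most of
the mass onto one point and an anchor itself serves; otherwise the variance absorbs the grid error,
or the anchor error does (`exists_mem_supportGrid_sum_le`). Moving all locations gives a candidate
on the grid of cost at most `(1 + ε/3) F`, which bounds the fixed-support optimum. For the instance
`That`, passing between `P` and `That` twice costs two factors `1 + ε/8` and terms `O(B/ε) = O(ε
F)`. -/

/-! ### Partial plans and the distance with outliers. -/

/-- A partial transport plan: everything `S` asks for is delivered, and no more than `P` has. -/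
structure IsPlan (P S : WSet d) (f : Pt d → Pt d → ℝ) : Prop where
  nonneg : ∀ p ∈ P.support, ∀ s ∈ S.support, 0 ≤ f p s
  out : ∀ p ∈ P.support, ∑ s ∈ S.support, f p s ≤ P p
  into : ∀ s ∈ S.support, ∑ p ∈ P.support, f p s = S s

lemma IsPlan.flowCost_nonneg {P S : WSet d} {f : Pt d → Pt d → ℝ} (hf : IsPlan P S f) :
    0 ≤ flowCost P S f :=
  Finset.sum_nonneg fun p hp => Finset.sum_nonneg fun s hs =>
    mul_nonneg (hf.nonneg p hp s hs) (sq_nonneg _)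

lemma wass_nonneg (P Q : WSet d) : 0 ≤ wass P Q := by
  apply Real.sInf_nonneg
  rintro _ ⟨f, -, rfl⟩
  exact Real.sqrt_nonneg _

lemma wassOut_nonneg (z : ℝ) (P Q : WSet d) : 0 ≤ wassOut z P Q := by
  apply Real.sInf_nonneg
  rintro _ ⟨f, -, rfl⟩
  exact wass_nonneg _ _

lemma wass_le {P Q : WSet d} {f : Pt d → Pt d → ℝ} (hf : IsFlow P Q f) :
    wass P Q ≤ √(flowCost P Q f) := by
  refine csInf_le ⟨0, ?_⟩ ⟨f, hf, rfl⟩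
  rintro _ ⟨f, -, rfl⟩
  exact Real.sqrt_nonneg _

lemma wassOut_le {z : ℝ} {P P' Q : WSet d} (h : P' ∈ inlierSets z P) :
    wassOut z P Q ≤ wass P' Q := by
  refine csInf_le ⟨0, ?_⟩ ⟨P', h, rfl⟩
  rintro _ ⟨f, -, rfl⟩
  exact wass_nonneg _ _

/-- The row sums of the plan are the inliers. With `exists_isPlan_flowCost_le` this merges the two
nested infima into one. -/
lemma wassOut_sq_le_flowCost {z : ℝ} {P S : WSet d} {f : Pt d → Pt d → ℝ}
    (hS : total S = total P - z) (hf : IsPlan P S f) :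
    wassOut z P S ^ 2 ≤ flowCost P S f := by
  classical
  have hrow : ∀ p ∈ P.support, 0 ≤ ∑ s ∈ S.support, f p s := fun p hp =>
    Finset.sum_nonneg fun s hs => hf.nonneg p hp s hs
  let P' : WSet d := Finsupp.onFinset P.support
    (fun p => if p ∈ P.support then Real.toNNReal (∑ s ∈ S.support, f p s) else 0)
    (by intro p hp; by_contra h; simp [h] at hp)
  have hP' : ∀ p ∈ P.support, (P' p : ℝ) = ∑ s ∈ S.support, f p s := by
    intro p hp
    simp only [P', Finsupp.onFinset_apply, if_pos hp]
    exact Real.coe_toNNReal _ (hrow p hp)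
  have hsub : P'.support ⊆ P.support := Finsupp.support_onFinset_subset
  -- A row with sum zero vanishes entirely, so leaving the support of `P'` changes neither marginals
  -- nor cost.
  have hzero : ∀ p ∈ P.support, p ∉ P'.support → ∀ s ∈ S.support, f p s = 0 := by
    intro p hp hp' s hs
    have h0 : ∑ s ∈ S.support, f p s = 0 := by
      rw [← hP' p hp, Finsupp.notMem_support_iff.1 hp']; rfl
    exact (Finset.sum_eq_zero_iff_of_nonneg (hf.nonneg p hp)).1 h0 s hs
  have hflow : IsFlow P' S f := by
    refine ⟨fun p hp s hs => hf.nonneg p (hsub hp) s hs, fun p hp => (hP' p (hsub hp)).symm, ?_⟩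
    intro s hs
    rw [← hf.into s hs]
    exact Finset.sum_subset hsub fun p hp hp' => hzero p hp hp' s hs
  have hcost : flowCost P' S f = flowCost P S f := by
    refine Finset.sum_subset hsub fun p hp hp' => Finset.sum_eq_zero fun s hs => ?_
    rw [hzero p hp hp' s hs, zero_mul]
  have hin : P' ∈ inlierSets z P := by
    refine ⟨fun p => ?_, ?_⟩
    · by_cases hp : p ∈ P.support
      · have := hf.out p hp
        rw [← hP' p hp] at this
        exact_mod_cast this
      · have : P' p = 0 := Finsupp.notMem_support_iff.1 fun h => hp (hsub h)
        rw [this]; exact zero_le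
    · rw [← hS]
      calc total P' = ∑ p ∈ P.support, (P' p : ℝ) :=
            Finset.sum_subset hsub fun p _ hp' => by
              rw [Finsupp.notMem_support_iff.1 hp']; rfl
        _ = ∑ p ∈ P.support, ∑ s ∈ S.support, f p s := Finset.sum_congr rfl hP'
        _ = ∑ s ∈ S.support, ∑ p ∈ P.support, f p s := Finset.sum_comm
        _ = total S := Finset.sum_congr rfl hf.into
  have h := (wassOut_le (Q := S) hin).trans (wass_le hflow)
  rw [hcost] at h
  calc wassOut z P S ^ 2 ≤ √(flowCost P S f) ^ 2 := by
        gcongr; exact wassOut_nonneg _ _ _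
    _ = flowCost P S f := Real.sq_sqrt hf.flowCost_nonneg

/-- The product flow; it rules out the default value `sInf ∅ = 0`, as scaling `P` down does in
`inlierSets_nonempty`. -/
lemma exists_isFlow {P Q : WSet d} (h : total P = total Q) (hQ : 0 < total Q) :
    ∃ f, IsFlow P Q f := by
  refine ⟨fun p q => P p * Q q / total Q, fun p _ q _ => by positivity, fun p _ => ?_,
    fun q _ => ?_⟩
  · rw [← Finset.sum_div, ← Finset.mul_sum]
    change (P p : ℝ) * total Q / total Q = P p
    field_simp
  · rw [← Finset.sum_div, ← Finset.sum_mul]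
    change total P * (Q q : ℝ) / total Q = Q q
    rw [h]; field_simp

lemma inlierSets_nonempty {z : ℝ} {P : WSet d} (hz : 0 ≤ z) (hzP : z < total P) :
    (inlierSets z P).Nonempty := by
  have hP : 0 < total P := hz.trans_lt hzP
  have hr0 : 0 < (total P - z) / total P := div_pos (by linarith) hP
  have hr1 : (total P - z) / total P ≤ 1 := (div_le_one hP).2 (by linarith)
  set r : ℝ≥0 := ((total P - z) / total P).toNNReal with hr
  have hrc : (r : ℝ) = (total P - z) / total P := Real.coe_toNNReal _ hr0.le
  have hrne : r ≠ 0 := fun h0 => hr0.ne' (by rw [← hrc, h0]; rfl)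
  refine ⟨r • P, fun p => ?_, ?_⟩
  · rw [Finsupp.smul_apply, smul_eq_mul]
    refine mul_le_of_le_one_left zero_le ?_
    rw [← NNReal.coe_le_coe, hrc]
    exact hr1
  · have hs : (r • P).support = P.support := Finsupp.support_smul_eq hrne
    unfold total
    rw [hs]
    simp only [Finsupp.smul_apply, smul_eq_mul, NNReal.coe_mul]
    rw [← Finset.mul_sum, hrc]
    change (total P - z) / total P * total P = total P - z
    field_simp

/-- The slack `η` makes attainment of the minima unnecessary. -/
lemma exists_isPlan_flowCost_le {z : ℝ} {P S : WSet d} (hz : 0 ≤ z) (hzP : z < total P)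
    (hS : total S = total P - z) {η : ℝ} (hη : 0 < η) :
    ∃ f, IsPlan P S f ∧ flowCost P S f ≤ wassOut z P S ^ 2 + η := by
  classical
  have hS0 : 0 < total S := by linarith
  have hW := wassOut_nonneg z P S
  have hlt : wassOut z P S < √(wassOut z P S ^ 2 + η) :=
    Real.lt_sqrt_of_sq_lt (by linarith)
  obtain ⟨_, ⟨P', hP', rfl⟩, h1⟩ :=
    exists_lt_of_csInf_lt ((inlierSets_nonempty hz hzP).image _) hlt
  obtain ⟨f₀, hf₀⟩ := exists_isFlow (P := P') (Q := S) (by rw [hP'.2, hS]) hS0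
  obtain ⟨_, ⟨f, hf, rfl⟩, h2⟩ := exists_lt_of_csInf_lt
    (s := (fun f => √(flowCost P' S f)) '' {f | IsFlow P' S f}) ⟨_, f₀, hf₀, rfl⟩ h1
  replace hf : IsFlow P' S f := hf
  have h3 : flowCost P' S f < wassOut z P S ^ 2 + η := by
    by_contra h
    exact absurd (Real.sqrt_le_sqrt (not_lt.1 h)) (not_le.2 h2)
  have hsub : P'.support ⊆ P.support := by
    intro p hp
    have h1 := hP'.1 p
    rw [Finsupp.mem_support_iff] at hp ⊢
    intro h0
    exact hp (le_antisymm (h0 ▸ h1) zero_le)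
  refine ⟨fun p s => if p ∈ P'.support then f p s else 0, ⟨fun p _ s hs => ?_, fun p _ => ?_,
    fun s hs => ?_⟩, ?_⟩
  · beta_reduce
    split_ifs with h
    · exact hf.nonneg p h s hs
    · exact le_rfl
  · beta_reduce
    split_ifs with h
    · rw [hf.out p h]; exact_mod_cast hP'.1 p
    · simp
  · rw [← hf.into s hs, ← Finset.sum_filter]
    congr 1
    ext p
    simp only [Finset.mem_filter, and_iff_right_iff_imp]
    exact fun h => hsub h
  · refine le_trans (le_of_eq ?_) h3.le
    unfold flowCost
    symm
    refine Finset.sum_subset_zero_on_sdiff hsub (fun p hp => ?_) (fun p hp => ?_)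
    · rw [Finset.mem_sdiff] at hp
      simp [hp.2]
    · simp only [if_pos hp]

/-! ### Plans under maps of points. -/

lemma support_mapDomain (P : WSet d) (g : Pt d → Pt d) [DecidableEq (Pt d)] :
    (P.mapDomain g).support = P.support.image g := by
  refine Finset.Subset.antisymm Finsupp.mapDomain_support fun q hq => ?_
  obtain ⟨p, hp, rfl⟩ := Finset.mem_image.1 hq
  rw [Finsupp.mem_support_iff, Finsupp.mapDomain, Finsupp.sum, Finsupp.finsetSum_apply]
  intro h0
  have := (Finset.sum_eq_zero_iff.1 h0) p hp
  rw [Finsupp.single_eq_same] at this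
  exact (Finsupp.mem_support_iff.1 hp) this

lemma mem_support_mapDomain {P : WSet d} (g : Pt d → Pt d) {p : Pt d} (hp : p ∈ P.support) :
    g p ∈ (P.mapDomain g).support := by
  classical
  rw [support_mapDomain]
  exact Finset.mem_image_of_mem g hp

lemma sum_mapDomain_mul (P : WSet d) (g : Pt d → Pt d) (φ : Pt d → ℝ) :
    ∑ q ∈ (P.mapDomain g).support, (P.mapDomain g q : ℝ) * φ q =
      ∑ p ∈ P.support, (P p : ℝ) * φ (g p) := by
  have := Finsupp.sum_mapDomain_index (f := g) (s := P) (h := fun q w => (w : ℝ) * φ q)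
    (by simp) (by intros; push_cast; ring)
  simpa [Finsupp.sum] using this

lemma mapDomain_eq_sum (P : WSet d) (g : Pt d → Pt d) (q : Pt d) [DecidableEq (Pt d)] :
    (P.mapDomain g q : ℝ) = ∑ p ∈ P.support with g p = q, (P p : ℝ) := by
  rw [Finsupp.mapDomain, Finsupp.sum, Finsupp.finsetSum_apply, NNReal.coe_sum, Finset.sum_filter]
  refine Finset.sum_congr rfl fun p _ => ?_
  rw [Finsupp.single_apply]
  split_ifs <;> simp

lemma total_mapDomain (P : WSet d) (g : Pt d → Pt d) : total (P.mapDomain g) = total P := by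
  simpa [total] using sum_mapDomain_mul P g (fun _ => 1)

lemma sum_support_mapDomain_fiber (P : WSet d) (g : Pt d → Pt d) (φ : Pt d → Pt d → ℝ)
    [DecidableEq (Pt d)] :
    ∑ q ∈ (P.mapDomain g).support, ∑ p ∈ P.support with g p = q, φ p q =
      ∑ p ∈ P.support, φ p (g p) := by
  rw [← Finset.sum_fiberwise_of_maps_to (g := g) (fun p hp => mem_support_mapDomain g hp)
    fun p => φ p (g p)]
  refine Finset.sum_congr rfl fun q _ => Finset.sum_congr rfl fun p hp => ?_
  rw [(Finset.mem_filter.1 hp).2]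

/-- Pushing a plan forward along a map of the source points. -/
lemma IsPlan.push_source {P S : WSet d} {f : Pt d → Pt d → ℝ} (hf : IsPlan P S f)
    (g : Pt d → Pt d) :
    ∃ f', IsPlan (P.mapDomain g) S f' ∧ flowCost (P.mapDomain g) S f' =
      ∑ p ∈ P.support, ∑ s ∈ S.support, f p s * dist (g p) s ^ 2 := by
  classical
  refine ⟨fun q s => ∑ p ∈ P.support with g p = q, f p s, ⟨fun q _ s hs => ?_, fun q _ => ?_,
    fun s hs => ?_⟩, ?_⟩
  · exact Finset.sum_nonneg fun p hp => hf.nonneg p (Finset.mem_filter.1 hp).1 s hs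
  · rw [Finset.sum_comm, mapDomain_eq_sum]
    exact Finset.sum_le_sum fun p hp => hf.out p (Finset.mem_filter.1 hp).1
  · rw [sum_support_mapDomain_fiber P g fun p _ => f p s]
    exact hf.into s hs
  · rw [← sum_support_mapDomain_fiber P g fun p q => ∑ s ∈ S.support, f p s * dist q s ^ 2]
    refine Finset.sum_congr rfl fun q _ => ?_
    rw [Finset.sum_comm]
    exact Finset.sum_congr rfl fun s _ => Finset.sum_mul _ _ _

/-- Pulling a plan back along a map of the source points. -/
lemma IsPlan.pull_source {P S : WSet d} {g : Pt d → Pt d} {f' : Pt d → Pt d → ℝ}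
    (hf : IsPlan (P.mapDomain g) S f') :
    ∃ f, IsPlan P S f ∧ flowCost (P.mapDomain g) S f' =
      ∑ p ∈ P.support, ∑ s ∈ S.support, f p s * dist (g p) s ^ 2 := by
  have hpos : ∀ q ∈ (P.mapDomain g).support, (0 : ℝ) < P.mapDomain g q := fun q hq => by
    exact_mod_cast pos_iff_ne_zero.2 (Finsupp.mem_support_iff.1 hq)
  -- The flow leaving an anchor is split among the points merged there in proportion to their
  -- weights.
  refine ⟨fun p s => P p * (f' (g p) s / P.mapDomain g (g p)), ⟨fun p hp s hs => ?_,
    fun p hp => ?_, fun s hs => ?_⟩, ?_⟩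
  · have := hf.nonneg _ (mem_support_mapDomain g hp) s hs
    positivity
  · rw [← Finset.mul_sum, ← Finset.sum_div]
    refine mul_le_of_le_one_right (by positivity) ?_
    rw [div_le_one (hpos _ (mem_support_mapDomain g hp))]
    exact hf.out _ (mem_support_mapDomain g hp)
  · rw [← sum_mapDomain_mul P g fun q => f' q s / P.mapDomain g q, ← hf.into s hs]
    refine Finset.sum_congr rfl fun q hq => ?_
    have := hpos q hq
    field_simp
  · have := sum_mapDomain_mul P g
      fun q => ∑ s ∈ S.support, f' q s / P.mapDomain g q * dist q s ^ 2
    simp only [Finset.mul_sum, ← mul_assoc] at this ⊢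
    rw [← this]
    refine Finset.sum_congr rfl fun q hq => Finset.sum_congr rfl fun s _ => ?_
    have := hpos q hq
    field_simp

/-- Pushing a plan forward along a map of the target points. -/
lemma IsPlan.push_target {P S : WSet d} {f : Pt d → Pt d → ℝ} (hf : IsPlan P S f)
    (x : Pt d → Pt d) :
    ∃ f', IsPlan P (S.mapDomain x) f' ∧ flowCost P (S.mapDomain x) f' =
      ∑ p ∈ P.support, ∑ s ∈ S.support, f p s * dist p (x s) ^ 2 := by
  classical
  refine ⟨fun p y => ∑ s ∈ S.support with x s = y, f p s, ⟨fun p hp y _ => ?_, fun p hp => ?_,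
    fun y hy => ?_⟩, ?_⟩
  · exact Finset.sum_nonneg fun s hs => hf.nonneg p hp s (Finset.mem_filter.1 hs).1
  · rw [sum_support_mapDomain_fiber S x fun s _ => f p s]
    exact hf.out p hp
  · rw [Finset.sum_comm, mapDomain_eq_sum]
    exact Finset.sum_congr rfl fun s hs => hf.into s (Finset.mem_filter.1 hs).1
  · refine Finset.sum_congr rfl fun p _ => ?_
    rw [← sum_support_mapDomain_fiber S x fun s y => f p s * dist p y ^ 2]
    exact Finset.sum_congr rfl fun y _ => Finset.sum_mul _ _ _

/-! ### Stability of the distance under moving the input. -/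

lemma dist_sq_le_young (a b c : Pt d) {t : ℝ} (ht : 0 < t) :
    dist a c ^ 2 ≤ (1 + t) * dist b c ^ 2 + (1 + 1 / t) * dist a b ^ 2 := by
  have h := dist_triangle a b c
  have h0 : dist a c ^ 2 ≤ (dist a b + dist b c) ^ 2 := by gcongr
  have h1 : 0 ≤ (t * dist b c - dist a b) ^ 2 / t := by positivity
  have h2 : (t * dist b c - dist a b) ^ 2 / t =
      t * dist b c ^ 2 - 2 * dist a b * dist b c + 1 / t * dist a b ^ 2 := by
    field_simp; ring
  nlinarith

/-- The cost of the assignment that moves every point `p` of `P` to `g p`. -/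
def moveCost (P : WSet d) (g : Pt d → Pt d) : ℝ :=
  ∑ p ∈ P.support, (P p : ℝ) * dist p (g p) ^ 2

lemma moveCost_nonneg (P : WSet d) (g : Pt d → Pt d) : 0 ≤ moveCost P g :=
  Finset.sum_nonneg fun _ _ => by positivity

lemma IsPlan.sum_mul_le {P S : WSet d} {f : Pt d → Pt d → ℝ} (hf : IsPlan P S f)
    {φ : Pt d → ℝ} (hφ : ∀ p, 0 ≤ φ p) :
    ∑ p ∈ P.support, ∑ s ∈ S.support, f p s * φ p ≤ ∑ p ∈ P.support, (P p : ℝ) * φ p := by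
  refine Finset.sum_le_sum fun p hp => ?_
  rw [← Finset.sum_mul]
  exact mul_le_mul_of_nonneg_right (hf.out p hp) (hφ p)

lemma IsPlan.sum_le_young {P S : WSet d} {f : Pt d → Pt d → ℝ} (hf : IsPlan P S f)
    {u v w : Pt d → Pt d → ℝ} {a b : ℝ} (h : ∀ p s, u p s ≤ a * v p s + b * w p s) :
    ∑ p ∈ P.support, ∑ s ∈ S.support, f p s * u p s ≤
      a * (∑ p ∈ P.support, ∑ s ∈ S.support, f p s * v p s) +
        b * ∑ p ∈ P.support, ∑ s ∈ S.support, f p s * w p s := by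
  simp only [Finset.mul_sum, ← Finset.sum_add_distrib]
  refine Finset.sum_le_sum fun p hp => Finset.sum_le_sum fun s hs => ?_
  nlinarith [mul_le_mul_of_nonneg_left (h p s) (hf.nonneg p hp s hs)]

/-- Young's inequality per unit of flow along a pushed plan; a plan takes at most `P p` from `p`, so
the error is at most `moveCost`. `wassOut_sq_le_mapDomain` is the converse, by pulling back. -/
lemma wassOut_mapDomain_sq_le {z t : ℝ} {P S : WSet d} (hz : 0 ≤ z) (hzP : z < total P)
    (hS : total S = total P - z) (g : Pt d → Pt d) (ht : 0 < t) :
    wassOut z (P.mapDomain g) S ^ 2 ≤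
      (1 + t) * wassOut z P S ^ 2 + (1 + 1 / t) * moveCost P g := by
  refine le_of_forall_pos_le_add fun η hη => ?_
  obtain ⟨f, hf, hle⟩ := exists_isPlan_flowCost_le hz hzP hS (div_pos hη (by linarith : 0 < 1 + t))
  obtain ⟨f', hf', heq⟩ := hf.push_source g
  have h1 := wassOut_sq_le_flowCost (z := z) (by rw [total_mapDomain, hS]) hf'
  have h2 := hf.sum_le_young (u := fun p s => dist (g p) s ^ 2) (v := fun p s => dist p s ^ 2)
    (w := fun p _ => dist p (g p) ^ 2) (a := 1 + t) (b := 1 + 1 / t) fun p s => by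
      simpa [dist_comm] using dist_sq_le_young (g p) p s ht
  have h3 := hf.sum_mul_le (φ := fun p => dist p (g p) ^ 2) fun _ => sq_nonneg _
  have h4 : (1 + t) * flowCost P S f ≤ (1 + t) * wassOut z P S ^ 2 + η := by
    calc (1 + t) * flowCost P S f ≤ (1 + t) * (wassOut z P S ^ 2 + η / (1 + t)) := by gcongr
      _ = _ := by field_simp
  have h5 := mul_le_mul_of_nonneg_left h3 (by positivity : 0 ≤ 1 + 1 / t)
  unfold flowCost at h4
  unfold moveCost
  linarith

lemma wassOut_sq_le_mapDomain {z t : ℝ} {P S : WSet d} (hz : 0 ≤ z) (hzP : z < total P)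
    (hS : total S = total P - z) (g : Pt d → Pt d) (ht : 0 < t) :
    wassOut z P S ^ 2 ≤
      (1 + t) * wassOut z (P.mapDomain g) S ^ 2 + (1 + 1 / t) * moveCost P g := by
  refine le_of_forall_pos_le_add fun η hη => ?_
  have htot := total_mapDomain P g
  obtain ⟨f', hf', hle⟩ := exists_isPlan_flowCost_le (P := P.mapDomain g) (S := S) hz
    (by rwa [htot]) (by rwa [htot]) (div_pos hη (by linarith : 0 < 1 + t))
  obtain ⟨f, hf, heq⟩ := hf'.pull_source
  have h1 := wassOut_sq_le_flowCost (z := z) hS hf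
  have h2 := hf.sum_le_young (u := fun p s => dist p s ^ 2) (v := fun p s => dist (g p) s ^ 2)
    (w := fun p _ => dist p (g p) ^ 2) (a := 1 + t) (b := 1 + 1 / t) fun p s =>
      dist_sq_le_young p (g p) s ht
  have h3 := hf.sum_mul_le (φ := fun p => dist p (g p) ^ 2) fun _ => sq_nonneg _
  have h4 : (1 + t) * flowCost (P.mapDomain g) S f' ≤
      (1 + t) * wassOut z (P.mapDomain g) S ^ 2 + η := by
    calc (1 + t) * flowCost (P.mapDomain g) S f'
        ≤ (1 + t) * (wassOut z (P.mapDomain g) S ^ 2 + η / (1 + t)) := by gcongr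
      _ = _ := by field_simp
  have h5 := mul_le_mul_of_nonneg_left h3 (by positivity : 0 ≤ 1 + 1 / t)
  rw [heq] at h4
  unfold flowCost at h1
  unfold moveCost
  linarith

/-! ### Grids and layers. -/

lemma center_mem_ballGrid (c : Pt d) {r : ℝ} (hr : 0 ≤ r) (a : ℝ) : c ∈ ballGrid c r a :=
  ⟨⟨0, by simp⟩, Metric.mem_closedBall_self hr⟩

/-- Rounding a real number towards zero to a multiple of `a`. -/
lemma exists_int_mul_near {a : ℝ} (ha : 0 < a) (y : ℝ) :
    ∃ v : ℤ, |y - a * v| ≤ a ∧ |a * v| ≤ |y| := by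
  rcases le_total 0 y with hy | hy
  · have h1 := Int.floor_le (y / a)
    have h2 := Int.lt_floor_add_one (y / a)
    rw [le_div_iff₀ ha] at h1
    rw [div_lt_iff₀ ha] at h2
    have h3 : (0 : ℝ) ≤ ⌊y / a⌋ := by exact_mod_cast Int.floor_nonneg.2 (by positivity)
    refine ⟨⌊y / a⌋, ?_, ?_⟩
    · rw [abs_le]; constructor <;> linarith
    · rw [abs_of_nonneg (by positivity), abs_of_nonneg hy]; linarith
  · have h1 := Int.le_ceil (y / a)
    have h2 := Int.ceil_lt_add_one (y / a)
    rw [div_le_iff₀ ha] at h1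
    have h2' : (⌈y / a⌉ : ℝ) - 1 < y / a := by linarith
    rw [lt_div_iff₀ ha] at h2'
    have h3 : (⌈y / a⌉ : ℝ) ≤ 0 := by
      exact_mod_cast Int.ceil_le.2 (by simpa using div_nonpos_of_nonpos_of_nonneg hy ha.le)
    refine ⟨⌈y / a⌉, ?_, ?_⟩
    · rw [abs_le]; constructor <;> linarith
    · rw [abs_of_nonpos (by nlinarith), abs_of_nonpos hy]; linarith

/-- The grid of side length `b / √d` in a ball has a point at distance at most `b` from every
point of the ball. -/
lemma exists_mem_ballGrid_dist_le {c y : Pt d} {r b : ℝ} (hb : 0 < b)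
    (hy : y ∈ Metric.closedBall c r) :
    ∃ x ∈ ballGrid c r (b / √d), dist y x ≤ b := by
  have hr : 0 ≤ r := dist_nonneg.trans (Metric.mem_closedBall.1 hy)
  rcases Nat.eq_zero_or_pos d with rfl | hd
  · exact ⟨c, center_mem_ballGrid c hr _, by rw [Subsingleton.elim y c, dist_self]; exact hb.le⟩
  have hd' : (0 : ℝ) < d := by exact_mod_cast hd
  have ha : 0 < b / √d := by positivity
  -- Rounding each offset towards the centre keeps the point in the ball, at the price of up to a
  -- full side length per coordinate.
  choose v hv1 hv2 using fun i => exists_int_mul_near ha (y i - c i)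
  refine ⟨WithLp.toLp 2 fun i => c i + b / √d * v i, ⟨⟨v, fun i => rfl⟩, ?_⟩, ?_⟩
  · rw [Metric.mem_closedBall] at hy ⊢
    refine le_trans ?_ hy
    rw [EuclideanSpace.dist_eq, EuclideanSpace.dist_eq]
    refine Real.sqrt_le_sqrt (Finset.sum_le_sum fun i _ => ?_)
    rw [Real.dist_eq, Real.dist_eq]
    refine pow_le_pow_left₀ (abs_nonneg _) ?_ 2
    simpa using hv2 i
  · rw [EuclideanSpace.dist_eq]
    refine Real.sqrt_le_iff.2 ⟨hb.le, ?_⟩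
    calc ∑ i, dist (y i) (c i + b / √d * v i) ^ 2 ≤ ∑ _i : Fin d, (b / √d) ^ 2 := by
          refine Finset.sum_le_sum fun i _ => ?_
          rw [Real.dist_eq]
          refine pow_le_pow_left₀ (abs_nonneg _) ?_ 2
          simpa [sub_sub] using hv1 i
      _ = b ^ 2 := by
          rw [Finset.sum_const, Finset.card_univ, Fintype.card_fin, nsmul_eq_mul, div_pow,
            Real.sq_sqrt hd'.le]
          field_simp

lemma exists_mem_layer {c p : Pt d} {r : ℝ} {H : ℕ} (h : dist p c ≤ r * 2 ^ H) :
    ∃ h ≤ H, p ∈ layer c r h := by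
  induction H with
  | zero => exact ⟨0, le_rfl, by simpa [layer] using h⟩
  | succ H ih =>
    by_cases h' : dist p c ≤ r * 2 ^ H
    · obtain ⟨i, hi, hp⟩ := ih h'
      exact ⟨i, hi.trans H.le_succ, hp⟩
    · exact ⟨H + 1, le_rfl, by simpa [layer] using ⟨h, not_le.1 h'⟩⟩

/-- A nearest point of the grid of a layer is close to every point of that layer. -/
lemma dist_sq_le_of_isNearest_layerGrid {c p g : Pt d} {α ε₁ r : ℝ} {h : ℕ} (hα : 1 ≤ α)
    (hε₁ : 0 < ε₁) (hr : 0 ≤ r) (hp : p ∈ layer c r h)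
    (hg : IsNearest (layerGrid α ε₁ c r h) p g) :
    dist p g ^ 2 ≤ ε₁ ^ 2 / α * (dist p c ^ 2 + r ^ 2 / 4) := by
  have hα0 : 0 < α := by linarith
  have hmem : p ∈ Metric.closedBall c (r * 2 ^ h) := by
    cases h with
    | zero => simpa [layer] using hp
    | succ h => exact hp.1
  rcases hr.eq_or_lt with rfl | hr
  · have hpc : p = c := by simpa using hmem
    have h0 := hg.2 c (center_mem_ballGrid c (by simp) _)
    rw [hpc, dist_self] at h0
    rw [hpc, le_antisymm h0 dist_nonneg, zero_pow two_ne_zero]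
    positivity
  have hside : r * ε₁ * (2 ^ h / 2) / √(α * d) = r * ε₁ * (2 ^ h / 2) / √α / √d := by
    rw [Real.sqrt_mul hα0.le, div_div]
  have hb : 0 < r * ε₁ * (2 ^ h / 2) / √α := by positivity
  obtain ⟨x, hx, hxd⟩ := exists_mem_ballGrid_dist_le hb hmem
  rw [← hside] at hx
  have h1 : dist p g ^ 2 ≤ (r * ε₁ * (2 ^ h / 2) / √α) ^ 2 := by
    have := (hg.2 x hx).trans hxd
    gcongr
  refine h1.trans ?_
  rw [div_pow, Real.sq_sqrt hα0.le, div_mul_eq_mul_div]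
  refine div_le_div_of_nonneg_right ?_ hα0.le
  -- Half the radius of the ball is the inner radius of an outer layer, hence below the distance to
  -- the centre; the innermost ball contributes `r² / 4` instead.
  have h2 : (r * (2 ^ h / 2)) ^ 2 ≤ dist p c ^ 2 + r ^ 2 / 4 := by
    cases h with
    | zero => nlinarith [sq_nonneg (dist p c)]
    | succ h =>
      have h3 : r * 2 ^ h < dist p c := by simpa using hp.2
      have h4 : r * (2 ^ (h + 1) / 2) = r * 2 ^ h := by rw [pow_succ]; ring
      rw [h4]
      have h5 : 0 ≤ r * 2 ^ h := by positivity
      nlinarith [sq_nonneg r]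
  nlinarith [mul_le_mul_of_nonneg_left h2 (sq_nonneg ε₁)]

lemma self_mem_supportGrid {ε₂ Δ : ℝ} {A : Set (Pt d)} {q : Pt d} (hq : q ∈ A) :
    q ∈ supportGrid ε₂ Δ A := by
  simp only [supportGrid, Set.mem_iUnion]
  exact ⟨q, hq, 0, Nat.zero_le _, center_mem_ballGrid q (by positivity) _⟩

lemma exists_mem_supportGrid_dist_le {ε₂ Δ : ℝ} (hε₂ : 0 < ε₂) {A : Set (Pt d)} {q c : Pt d}
    (hq : q ∈ A) (hc : dist c q ≤ 2 ^ ⌈Real.logb 2 Δ⌉₊) :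
    ∃ x ∈ supportGrid ε₂ Δ A, dist c x ^ 2 ≤ ε₂ ^ 2 * (dist c q ^ 2 + 1 / 4) := by
  obtain ⟨h, hh, hl⟩ := exists_mem_layer (c := q) (p := c) (r := 1) (by simpa using hc)
  have hmem : c ∈ Metric.closedBall q (2 ^ h) := by
    cases h with
    | zero => simpa [layer] using hl
    | succ h => simpa using hl.1
  obtain ⟨x, hx, hxd⟩ := exists_mem_ballGrid_dist_le (b := ε₂ * (2 ^ h / 2)) (by positivity) hmem
  refine ⟨x, ?_, ?_⟩
  · simp only [supportGrid, Set.mem_iUnion]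
    exact ⟨q, hq, h, hh, hx⟩
  · have h1 : dist c x ^ 2 ≤ (ε₂ * (2 ^ h / 2)) ^ 2 := by gcongr
    have h2 : ((2 : ℝ) ^ h / 2) ^ 2 ≤ dist c q ^ 2 + 1 / 4 := by
      cases h with
      | zero => nlinarith [sq_nonneg (dist c q)]
      | succ h =>
        have h3 : (2 : ℝ) ^ h < dist c q := by simpa using hl.2
        have h4 : (2 : ℝ) ^ (h + 1) / 2 = 2 ^ h := by rw [pow_succ]; ring
        rw [h4]
        have h5 : (0 : ℝ) ≤ 2 ^ h := by positivity
        nlinarith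
    nlinarith [mul_le_mul_of_nonneg_left h2 (sq_nonneg ε₂)]

lemma le_two_pow_ceil_logb {x : ℝ} (hx : 0 < x) : x ≤ 2 ^ ⌈Real.logb 2 x⌉₊ := by
  calc x = (2 : ℝ) ^ Real.logb 2 x := (Real.rpow_logb (by norm_num) (by norm_num) hx).symm
    _ ≤ (2 : ℝ) ^ ((⌈Real.logb 2 x⌉₊ : ℕ) : ℝ) :=
        Real.rpow_le_rpow_of_exponent_le (by norm_num) (Nat.le_ceil _)
    _ = _ := Real.rpow_natCast _ _

/-! ### Weighted means and variance. -/

section Weighted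

variable {ι : Type*} {I : Finset ι} {μ : ι → ℝ}

lemma exists_weight_pos_mul_le (hμ : ∀ i ∈ I, 0 ≤ μ i) (hM : 0 < ∑ i ∈ I, μ i) (v : ι → ℝ) :
    ∃ i ∈ I, 0 < μ i ∧ (∑ i ∈ I, μ i) * v i ≤ ∑ i ∈ I, μ i * v i := by
  by_contra! hcon
  have hex : ∃ i ∈ I, 0 < μ i := by
    by_contra! h
    exact absurd (Finset.sum_nonpos h) (not_le.2 hM)
  have : ∑ i ∈ I, μ i * (∑ k ∈ I, μ k * v k) < ∑ i ∈ I, μ i * ((∑ k ∈ I, μ k) * v i) := by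
    refine Finset.sum_lt_sum (fun i hi => ?_) ?_
    · rcases (hμ i hi).eq_or_lt with h | h
      · simp [← h]
      · exact (mul_lt_mul_of_pos_left (hcon i hi h) h).le
    · obtain ⟨i, hi, h⟩ := hex
      exact ⟨i, hi, mul_lt_mul_of_pos_left (hcon i hi h) h⟩
  rw [← Finset.sum_mul, Finset.mul_sum] at this
  refine absurd this (not_lt.2 (le_of_eq ?_))
  exact Finset.sum_congr rfl fun i _ => by ring

/-- The centre of mass. -/
def centroid (I : Finset ι) (μ : ι → ℝ) (p : ι → Pt d) : Pt d :=
  (∑ i ∈ I, μ i)⁻¹ • ∑ i ∈ I, μ i • p i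

lemma smul_sub_centroid (hM : 0 < ∑ i ∈ I, μ i) (p : ι → Pt d) (x : Pt d) :
    (∑ i ∈ I, μ i) • (centroid I μ p - x) = ∑ i ∈ I, μ i • (p i - x) := by
  rw [centroid, smul_sub, smul_smul, mul_inv_cancel₀ hM.ne', one_smul]
  simp only [smul_sub, Finset.sum_sub_distrib, Finset.sum_smul]

/-- Huygens' formula. -/
lemma sum_mul_dist_sq_eq (hM : 0 < ∑ i ∈ I, μ i) (p : ι → Pt d) (x : Pt d) :
    ∑ i ∈ I, μ i * dist (p i) x ^ 2 = ∑ i ∈ I, μ i * dist (p i) (centroid I μ p) ^ 2 +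
      (∑ i ∈ I, μ i) * dist (centroid I μ p) x ^ 2 := by
  set c := centroid I μ p with hc
  have h0 : ∑ i ∈ I, μ i • (p i - c) = 0 := by
    rw [← smul_sub_centroid hM, ← hc, sub_self, smul_zero]
  have h1 : ∀ i, dist (p i) x ^ 2 =
      dist (p i) c ^ 2 + 2 * inner ℝ (p i - c) (c - x) + dist c x ^ 2 := by
    intro i
    rw [dist_eq_norm, dist_eq_norm, dist_eq_norm, ← sub_add_sub_cancel (p i) c x,
      norm_add_sq_real]
  have h2 : ∑ i ∈ I, μ i * (2 * inner ℝ (p i - c) (c - x)) = 0 := by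
    have : ∑ i ∈ I, μ i * (2 * inner ℝ (p i - c) (c - x)) =
        2 * inner ℝ (∑ i ∈ I, μ i • (p i - c)) (c - x) := by
      rw [sum_inner, Finset.mul_sum]
      refine Finset.sum_congr rfl fun i _ => ?_
      rw [real_inner_smul_left]; ring
    rw [this, h0, inner_zero_left, mul_zero]
  simp only [h1, mul_add, Finset.sum_add_distrib, h2, Finset.sum_mul]
  ring

/-- If the pairwise distances are at most `Δ`, the variance is at most `Δ² / 2`. -/
lemma two_mul_variance_le (hμ : ∀ i ∈ I, 0 ≤ μ i) (hM : 0 < ∑ i ∈ I, μ i) {p : ι → Pt d}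
    {Δ : ℝ} (hΔ : ∀ i ∈ I, ∀ j ∈ I, dist (p i) (p j) ≤ Δ) :
    2 * ∑ i ∈ I, μ i * dist (p i) (centroid I μ p) ^ 2 ≤ (∑ i ∈ I, μ i) * Δ ^ 2 := by
  set c := centroid I μ p
  -- Some `p k` has at least the average squared distance to the centroid; Huygens' formula at `x =
  -- p k` then counts the variance twice.
  obtain ⟨k, hk, -, hle⟩ := exists_weight_pos_mul_le hμ hM fun i => -dist (p i) c ^ 2
  simp only [mul_neg, Finset.sum_neg_distrib, neg_le_neg_iff] at hle
  have h1 := sum_mul_dist_sq_eq hM p (p k)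
  have h2 : ∑ i ∈ I, μ i * dist (p i) (p k) ^ 2 ≤ (∑ i ∈ I, μ i) * Δ ^ 2 := by
    rw [Finset.sum_mul]
    refine Finset.sum_le_sum fun i hi => mul_le_mul_of_nonneg_left ?_ (hμ i hi)
    have := hΔ i hi k hk
    gcongr
  rw [dist_comm _ (p k)] at h1
  linarith

end Weighted

/-! ### Extra centres versus outliers. -/

/-- A set of `N` points with the largest values of `D`, together with a separating threshold. -/
lemma exists_largest {X : Type*} [DecidableEq X] (s : Finset X) (D : X → ℝ)
    (hD : ∀ p ∈ s, 0 ≤ D p) (N : ℕ) :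
    ∃ O ⊆ s, O.card ≤ N ∧ (O = s ∨ O.card = N) ∧
      ∃ D₀ : ℝ, 0 ≤ D₀ ∧ (∀ p ∈ s \ O, D p ≤ D₀) ∧ ∀ o ∈ O, D₀ ≤ D o := by
  induction N with
  | zero =>
    refine ⟨∅, by simp, by simp, by simp, ∑ p ∈ s, D p, Finset.sum_nonneg hD, fun p hp => ?_,
      by simp⟩
    exact Finset.single_le_sum hD (Finset.mem_sdiff.1 hp).1
  | succ N ih =>
    obtain ⟨O, hO, hc, hor, D₀, h0, h1, h2⟩ := ih
    by_cases hs : O = s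
    · exact ⟨O, hO, hc.trans N.le_succ, Or.inl hs, D₀, h0, h1, h2⟩
    have hcard := hor.resolve_left hs
    have hne : (s \ O).Nonempty :=
      Finset.sdiff_nonempty.2 fun h => hs (Finset.Subset.antisymm hO h)
    obtain ⟨x, hx, hmax⟩ := Finset.exists_max_image (s \ O) D hne
    obtain ⟨hxs, hxO⟩ := Finset.mem_sdiff.1 hx
    have hcard' : (insert x O).card = N + 1 := by rw [Finset.card_insert_of_notMem hxO, hcard]
    refine ⟨insert x O, Finset.insert_subset hxs hO, hcard'.le, Or.inr hcard', D x, hD x hxs,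
      fun p hp => hmax p ?_, fun o ho => ?_⟩
    · simp only [Finset.mem_sdiff, Finset.mem_insert, not_or] at hp ⊢
      exact ⟨hp.1, hp.2.2⟩
    · rcases Finset.mem_insert.1 ho with rfl | ho
      · exact le_rfl
      · exact (h1 x hx).trans (h2 o ho)

lemma exists_fin_cover {X : Type*} [Inhabited X] (U : Finset X) {K : ℕ} (hU : U.card ≤ K) :
    ∃ C : Fin K → X, ∀ x ∈ U, ∃ s, C s = x := by
  refine ⟨fun i => if h : (i : ℕ) < U.card then U.equivFin.symm ⟨i, h⟩ else default,
    fun x hx => ⟨Fin.castLE hU (U.equivFin ⟨x, hx⟩), ?_⟩⟩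
  simp

lemma iInf_dist_sq_le {K : ℕ} (C : Fin K → Pt d) (p : Pt d) (s : Fin K) :
    ⨅ s, dist p (C s) ^ 2 ≤ dist p (C s) ^ 2 :=
  ciInf_le (Set.finite_range _).bddBelow s

lemma kmeansOpt_le_kmeansCost {K : ℕ} (P : WSet d) (C : Fin K → Pt d) :
    kmeansOpt K P ≤ kmeansCost P C := by
  refine ciInf_le ⟨0, ?_⟩ C
  rintro _ ⟨C, rfl⟩
  exact Finset.sum_nonneg fun p _ =>
    mul_nonneg (by positivity) (Real.iInf_nonneg fun s => sq_nonneg _)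

/-- Discarding weight `z` is never better than opening `N ≥ z / w` additional centres, if every
point has weight at least `w`. -/
lemma kmeansOpt_le_flowCost {z w : ℝ} {k N : ℕ} {P S : WSet d} {f : Pt d → Pt d → ℝ}
    (hf : IsPlan P S f) (hS : total S = total P - z) (hS0 : 0 < total S)
    (hk : S.support.card ≤ k) (hw : ∀ p ∈ P.support, w ≤ P p) (hN : z ≤ N * w) :
    kmeansOpt (k + N) P ≤ flowCost P S f := by
  classical
  have hne : S.support.Nonempty := by
    by_contra h
    rw [Finset.not_nonempty_iff_eq_empty] at h
    simp [total, h] at hS0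
  set D : Pt d → ℝ := fun p => S.support.inf' hne fun s => dist p s ^ 2 with hD
  have hD0 : ∀ p, 0 ≤ D p := fun p => (Finset.le_inf'_iff _ _).2 fun s _ => sq_nonneg _
  have hDle : ∀ p, ∀ s ∈ S.support, D p ≤ dist p s ^ 2 := fun p s hs =>
    Finset.inf'_le (fun s => dist p s ^ 2) hs
  set row : Pt d → ℝ := fun p => ∑ s ∈ S.support, f p s with hrow
  have hrow0 : ∀ p ∈ P.support, 0 ≤ row p := fun p hp => Finset.sum_nonneg (hf.nonneg p hp)
  obtain ⟨O, hO, hOc, hor, D₀, hD₀, hlow, hhigh⟩ :=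
    exists_largest P.support D (fun p _ => hD0 p) N
  obtain ⟨C, hC⟩ := exists_fin_cover (K := k + N) (S.support ∪ O)
    ((Finset.card_union_le _ _).trans (add_le_add hk hOc))
  have hκ1 : ∀ p, ⨅ s, dist p (C s) ^ 2 ≤ D p := fun p =>
    (Finset.le_inf'_iff _ _).2 fun s hs => by
      obtain ⟨i, rfl⟩ := hC s (Finset.mem_union_left _ hs)
      exact iInf_dist_sq_le C p i
  have hκ2 : ∀ p ∈ O, ⨅ s, dist p (C s) ^ 2 ≤ 0 := fun p hp => by
    obtain ⟨i, hi⟩ := hC p (Finset.mem_union_right _ hp)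
    simpa [hi] using iInf_dist_sq_le C p i
  have hsplit : ∀ φ : Pt d → ℝ,
      ∑ p ∈ P.support, φ p = ∑ p ∈ P.support \ O, φ p + ∑ p ∈ O, φ p := fun φ =>
    (Finset.sum_sdiff hO).symm
  have hcost : kmeansCost P C ≤ ∑ p ∈ P.support \ O, (P p : ℝ) * D p := by
    rw [kmeansCost, hsplit]
    have h1 : ∑ p ∈ O, (P p : ℝ) * ⨅ s, dist p (C s) ^ 2 ≤ 0 :=
      Finset.sum_nonpos fun p hp => mul_nonpos_of_nonneg_of_nonpos (by positivity) (hκ2 p hp)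
    have h2 : ∑ p ∈ P.support \ O, (P p : ℝ) * ⨅ s, dist p (C s) ^ 2 ≤
        ∑ p ∈ P.support \ O, (P p : ℝ) * D p :=
      Finset.sum_le_sum fun p _ => mul_le_mul_of_nonneg_left (hκ1 p) (by positivity)
    linarith
  have hflow : ∑ p ∈ P.support, row p * D p ≤ flowCost P S f := by
    refine Finset.sum_le_sum fun p hp => ?_
    rw [hrow, Finset.sum_mul]
    exact Finset.sum_le_sum fun s hs =>
      mul_le_mul_of_nonneg_left (hDle p s hs) (hf.nonneg p hp s hs)
  -- Exchange argument: the plan discards `z` in all and `O` weighs at least `z`, unless it is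
  -- everything. So the weight discarded outside `O` is at most the weight served inside, and `D₀`
  -- separates the prices.
  have hrest : ∑ p ∈ P.support \ O, ((P p : ℝ) - row p) * D p ≤
      ∑ p ∈ O, row p * D p := by
    rcases hor with rfl | hcard
    · rw [Finset.sdiff_self, Finset.sum_empty]
      exact Finset.sum_nonneg fun p hp => mul_nonneg (hrow0 p hp) (hD0 p)
    have h1 : ∑ p ∈ P.support \ O, ((P p : ℝ) - row p) * D p ≤
        (∑ p ∈ P.support \ O, ((P p : ℝ) - row p)) * D₀ := by
      rw [Finset.sum_mul]
      refine Finset.sum_le_sum fun p hp => mul_le_mul_of_nonneg_left (hlow p hp) ?_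
      exact sub_nonneg.2 (hf.out p (Finset.mem_sdiff.1 hp).1)
    have h2 : (∑ p ∈ O, row p) * D₀ ≤ ∑ p ∈ O, row p * D p := by
      rw [Finset.sum_mul]
      exact Finset.sum_le_sum fun p hp => mul_le_mul_of_nonneg_left (hhigh p hp) (hrow0 p (hO hp))
    have h3 : ∑ p ∈ P.support, ((P p : ℝ) - row p) = z := by
      rw [Finset.sum_sub_distrib, hrow, Finset.sum_comm, Finset.sum_congr rfl hf.into]
      change total P - total S = z
      linarith
    rw [hsplit, Finset.sum_sub_distrib (s := O)] at h3
    have h4 : N * w ≤ ∑ p ∈ O, (P p : ℝ) := by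
      rw [← hcard, ← nsmul_eq_mul]
      exact Finset.card_nsmul_le_sum _ _ _ fun p hp => hw p (hO hp)
    have h5 : ∑ p ∈ P.support \ O, ((P p : ℝ) - row p) ≤ ∑ p ∈ O, row p := by linarith
    exact h1.trans ((mul_le_mul_of_nonneg_right h5 hD₀).trans h2)
  have hrow_split := hsplit fun p => row p * D p
  simp only [sub_mul, Finset.sum_sub_distrib] at hrest
  linarith [kmeansOpt_le_kmeansCost P C]

/-! ### The cost of moving to anchors. -/

section Assignment

variable {K : ℕ} {P : WSet d} {T : Fin K → Pt d} {σ : Pt d → Fin K}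

lemma kmeansCost_eq_moveCost (hσ : ∀ p ∈ P.support, ∀ s, dist p (T (σ p)) ≤ dist p (T s)) :
    kmeansCost P T = moveCost P fun p => T (σ p) := by
  refine Finset.sum_congr rfl fun p hp => ?_
  congr 1
  have : Nonempty (Fin K) := ⟨σ p⟩
  refine le_antisymm (iInf_dist_sq_le T p (σ p)) (le_ciInf fun s => ?_)
  have := hσ p hp s
  gcongr

/-- Any flow into the centres pays at least the nearest-centre price per unit, so nearest assignment
is an optimal transport. This ties the base radius to the clustering cost. -/
lemma wass_centreSet_sq (hσ : ∀ p ∈ P.support, ∀ s, dist p (T (σ p)) ≤ dist p (T s)) :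
    wass P (centreSet P T σ) ^ 2 = moveCost P fun p => T (σ p) := by
  classical
  have hmem : ∀ p ∈ P.support, T (σ p) ∈ (centreSet P T σ).support := fun p hp =>
    mem_support_mapDomain (fun p => T (σ p)) hp
  have hflow : IsFlow P (centreSet P T σ) fun p q => if T (σ p) = q then (P p : ℝ) else 0 := by
    refine ⟨fun p _ q _ => ?_, fun p hp => ?_, fun q _ => ?_⟩
    · beta_reduce
      split_ifs
      · positivity
      · exact le_rfl
    · rw [Finset.sum_ite_eq, if_pos (hmem p hp)]
    · rw [centreSet, mapDomain_eq_sum, Finset.sum_filter]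
  have hcost : flowCost P (centreSet P T σ) (fun p q => if T (σ p) = q then (P p : ℝ) else 0) =
      moveCost P fun p => T (σ p) := by
    refine Finset.sum_congr rfl fun p hp => ?_
    simp only [ite_mul, zero_mul]
    rw [Finset.sum_ite_eq, if_pos (hmem p hp)]
  have h0 := moveCost_nonneg P fun p => T (σ p)
  have hle : wass P (centreSet P T σ) ≤ √(moveCost P fun p => T (σ p)) := by
    rw [← hcost]; exact wass_le hflow
  have hge : √(moveCost P fun p => T (σ p)) ≤ wass P (centreSet P T σ) := by
    refine le_csInf ⟨_, _, hflow, rfl⟩ ?_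
    rintro _ ⟨f, hf, rfl⟩
    replace hf : IsFlow P (centreSet P T σ) f := hf
    refine Real.sqrt_le_sqrt (Finset.sum_le_sum fun p hp => ?_)
    rw [← hf.out p hp, Finset.sum_mul]
    refine Finset.sum_le_sum fun q hq => mul_le_mul_of_nonneg_left ?_ (hf.nonneg p hp q hq)
    rw [centreSet, support_mapDomain] at hq
    obtain ⟨p', -, rfl⟩ := Finset.mem_image.1 hq
    have := hσ p hp (σ p')
    gcongr
  rw [le_antisymm hle hge, Real.sq_sqrt h0]

/-- The anchor construction moves the points at a cost proportional to the clustering cost. -/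
lemma moveCost_anchor_le {α ε₁ n : ℝ} {g : Pt d → Pt d} (hα : 1 ≤ α) (hε₁ : 0 < ε₁)
    (hn : 0 < n) (hP : total P = n) (hw : ∀ p ∈ P.support, 1 / n ≤ (P p : ℝ))
    (hσ : ∀ p ∈ P.support, ∀ s, dist p (T (σ p)) ≤ dist p (T s))
    (hg : ∀ p ∈ P.support, ∀ h ≤ ⌈Real.logb 2 n⌉₊,
      p ∈ layer (T (σ p)) (baseRadius n P T σ) h →
        IsNearest (layerGrid α ε₁ (T (σ p)) (baseRadius n P T σ) h) p (g p)) :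
    moveCost P g ≤ ε₁ ^ 2 / α * (5 / 4 * kmeansCost P T) := by
  have hα0 : 0 < α := by linarith
  have hM0 := moveCost_nonneg P fun p => T (σ p)
  rw [kmeansCost_eq_moveCost hσ]
  set M := moveCost P fun p => T (σ p) with hM
  set r := baseRadius n P T σ with hr
  have hr0 : 0 ≤ r := Real.sqrt_nonneg _
  have hr2 : n * r ^ 2 = M := by
    rw [hr, baseRadius, wass_centreSet_sq hσ, Real.sq_sqrt (by positivity)]
    field_simp
    exact hM.symm
  have hpt : ∀ p ∈ P.support,
      dist p (g p) ^ 2 ≤ ε₁ ^ 2 / α * (dist p (T (σ p)) ^ 2 + r ^ 2 / 4) := by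
    intro p hp
    -- One point contributes at most `M = n r²` and weighs at least `1 / n`, so it lies within `r *
    -- n` of its centre and the layers reach it.
    have h1 : (P p : ℝ) * dist p (T (σ p)) ^ 2 ≤ n * r ^ 2 := by
      rw [hr2]
      exact Finset.single_le_sum (f := fun p => (P p : ℝ) * dist p (T (σ p)) ^ 2)
        (fun _ _ => by positivity) hp
    have h2 : 1 / n * dist p (T (σ p)) ^ 2 ≤ n * r ^ 2 :=
      (mul_le_mul_of_nonneg_right (hw p hp) (sq_nonneg _)).trans h1
    have h3 : dist p (T (σ p)) ^ 2 ≤ (r * n) ^ 2 := by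
      rw [one_div, inv_mul_le_iff₀ hn] at h2
      linarith
    have h4 : dist p (T (σ p)) ≤ r * n := (sq_le_sq₀ dist_nonneg (by positivity)).1 h3
    obtain ⟨h, hh, hl⟩ := exists_mem_layer
      (h4.trans (mul_le_mul_of_nonneg_left (le_two_pow_ceil_logb hn) hr0))
    exact dist_sq_le_of_isNearest_layerGrid hα hε₁ hr0 hl (hg p hp h hh hl)
  calc moveCost P g
      ≤ ∑ p ∈ P.support, (P p : ℝ) * (ε₁ ^ 2 / α * (dist p (T (σ p)) ^ 2 + r ^ 2 / 4)) :=
        Finset.sum_le_sum fun p hp => mul_le_mul_of_nonneg_left (hpt p hp) (by positivity)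
    _ = ε₁ ^ 2 / α * (M + total P * (r ^ 2 / 4)) := by
        rw [hM, moveCost, total, Finset.sum_mul, ← Finset.sum_add_distrib, Finset.mul_sum]
        exact Finset.sum_congr rfl fun p _ => by ring
    -- The additive terms `r² / 4` sum to `M / 4`.
    _ = ε₁ ^ 2 / α * (5 / 4 * M) := by rw [hP, ← hr2]; ring

end Assignment

/-! ### Serving masses from the support grid. -/

section Weighted

variable {ι : Type*} {I : Finset ι} {μ : ι → ℝ}

/-- Distances that are `0` or at least `1` are bounded by their squares; this bounds first moments
by the variance. -/
lemma dist_le_four_mul_sq {p p₀ c : Pt d} (hsep : p ≠ p₀ → 1 ≤ dist p p₀)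
    (hnear : dist p₀ c ≤ dist p c) : dist p p₀ ≤ 4 * dist p c ^ 2 := by
  by_cases h : p = p₀
  · rw [h, dist_self]; positivity
  · have h1 := hsep h
    have h2 : dist p p₀ ≤ 2 * dist p c := by
      linarith [dist_triangle_right p p₀ c]
    nlinarith

/-- If the centroid is concentrated near one location, an anchor of that location is good. -/
lemma exists_anchor_near_centroid (hμ : ∀ i ∈ I, 0 ≤ μ i) (hM : 0 < ∑ i ∈ I, μ i)
    {p q : ι → Pt d} (hsep : ∀ i ∈ I, ∀ j ∈ I, p i ≠ p j → 1 ≤ dist (p i) (p j)) {τ : ℝ}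
    (hτ1 : τ ≤ 1 / 16)
    (hD : ∑ i ∈ I, μ i * dist (p i) (centroid I μ p) ^ 2 < τ * ∑ i ∈ I, μ i) :
    ∃ i ∈ I, (∑ i ∈ I, μ i) * dist (centroid I μ p) (q i) ^ 2 ≤
      32 * τ * (∑ i ∈ I, μ i * dist (p i) (centroid I μ p) ^ 2) +
        12 * ∑ i ∈ I, μ i * dist (p i) (q i) ^ 2 := by
  classical
  set c := centroid I μ p
  set M := ∑ i ∈ I, μ i
  set D := ∑ i ∈ I, μ i * dist (p i) c ^ 2
  set E := ∑ i ∈ I, μ i * dist (p i) (q i) ^ 2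
  have hD0 : 0 ≤ D := Finset.sum_nonneg fun i hi => mul_nonneg (hμ i hi) (sq_nonneg _)
  have hE0 : 0 ≤ E := Finset.sum_nonneg fun i hi => mul_nonneg (hμ i hi) (sq_nonneg _)
  have hne : I.Nonempty := Finset.nonempty_of_sum_ne_zero hM.ne'
  obtain ⟨k, hk, hmin⟩ := Finset.exists_min_image I (fun i => dist (p i) c) hne
  have h4 : ∀ i ∈ I, dist (p i) (p k) ≤ 4 * dist (p i) c ^ 2 := fun i hi =>
    dist_le_four_mul_sq (hsep i hi k hk) (hmin i hi)
  -- A first moment bounds the offset of the centroid by `4 D / M` rather than its square root,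
  -- which yields the factor `τ`.
  have hδ : M * dist c (p k) ≤ 4 * D := by
    calc M * dist c (p k) = ‖M • (c - p k)‖ := by
          rw [norm_smul, Real.norm_of_nonneg hM.le, dist_eq_norm]
      _ = ‖∑ i ∈ I, μ i • (p i - p k)‖ := by rw [smul_sub_centroid hM]
      _ ≤ ∑ i ∈ I, ‖μ i • (p i - p k)‖ := norm_sum_le _ _
      _ ≤ ∑ i ∈ I, 4 * (μ i * dist (p i) c ^ 2) := by
          refine Finset.sum_le_sum fun i hi => ?_
          rw [norm_smul, Real.norm_of_nonneg (hμ i hi), ← dist_eq_norm]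
          nlinarith [mul_le_mul_of_nonneg_left (h4 i hi) (hμ i hi)]
      _ = 4 * D := by rw [Finset.mul_sum]
  set M₀ := ∑ i ∈ I with p i = p k, μ i with hM₀
  have hoff : M - M₀ ≤ 4 * D := by
    have h1 : M₀ + ∑ i ∈ I with ¬ p i = p k, μ i = M :=
      Finset.sum_filter_add_sum_filter_not I (fun i => p i = p k) μ
    have h2 : ∑ i ∈ I with ¬ p i = p k, μ i ≤
        ∑ i ∈ I with ¬ p i = p k, 4 * (μ i * dist (p i) c ^ 2) := by
      refine Finset.sum_le_sum fun i hi => ?_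
      obtain ⟨hi, hik⟩ := Finset.mem_filter.1 hi
      have h5 := (hsep i hi k hk hik).trans (h4 i hi)
      nlinarith [mul_le_mul_of_nonneg_left h5 (hμ i hi)]
    have h3 : ∑ i ∈ I with ¬ p i = p k, 4 * (μ i * dist (p i) c ^ 2) ≤ 4 * D := by
      rw [Finset.mul_sum]
      exact Finset.sum_le_sum_of_subset_of_nonneg (Finset.filter_subset _ _) fun i hi _ =>
        mul_nonneg (by norm_num) (mul_nonneg (hμ i hi) (sq_nonneg _))
    linarith
  -- Since `4 D < 4 τ M ≤ M / 4`, most of the mass sits exactly at `p k`; averaging over it finds a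
  -- good anchor.
  have hM₀pos : 3 / 4 * M ≤ M₀ := by nlinarith
  obtain ⟨i, hi, -, hle⟩ := exists_weight_pos_mul_le (I := I.filter fun i => p i = p k)
    (fun i hi => hμ i (Finset.mem_filter.1 hi).1) (by linarith) fun i => dist (p i) (q i) ^ 2
  obtain ⟨hiI, hik⟩ := Finset.mem_filter.1 hi
  rw [← hM₀, hik] at hle
  have hE : ∑ i ∈ I with p i = p k, μ i * dist (p i) (q i) ^ 2 ≤ E :=
    Finset.sum_le_sum_of_subset_of_nonneg (Finset.filter_subset _ _) fun i hi _ =>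
      mul_nonneg (hμ i hi) (sq_nonneg _)
  refine ⟨i, hiI, ?_⟩
  have h6 : dist c (q i) ^ 2 ≤ 2 * dist c (p k) ^ 2 + 2 * dist (p k) (q i) ^ 2 := by
    nlinarith [dist_triangle c (p k) (q i), sq_nonneg (dist c (p k) - dist (p k) (q i)),
      dist_nonneg (x := c) (y := q i)]
  have h7 : M * dist (p k) (q i) ^ 2 ≤ 4 / 3 * E := by
    nlinarith [mul_le_mul_of_nonneg_right hM₀pos (sq_nonneg (dist (p k) (q i)))]
  have h8 : dist c (p k) ≤ 4 * τ := by nlinarith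
  have h9 : M * dist c (p k) ^ 2 ≤ 4 * D * (4 * τ) := by
    calc M * dist c (p k) ^ 2 = M * dist c (p k) * dist c (p k) := by ring
      _ ≤ 4 * D * (4 * τ) := by gcongr
  nlinarith [mul_le_mul_of_nonneg_left h6 hM.le]

/-- Some anchor is close to the centroid on average. -/
lemma exists_anchor_dist_centroid_le (hμ : ∀ i ∈ I, 0 ≤ μ i) (hM : 0 < ∑ i ∈ I, μ i)
    (p q : ι → Pt d) (c : Pt d) :
    ∃ i ∈ I, (∑ i ∈ I, μ i) * dist c (q i) ^ 2 ≤
      3 / 2 * (∑ i ∈ I, μ i * dist (p i) c ^ 2) + 3 * ∑ i ∈ I, μ i * dist (p i) (q i) ^ 2 := by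
  obtain ⟨i, hi, -, hle⟩ := exists_weight_pos_mul_le hμ hM fun i => dist c (q i) ^ 2
  refine ⟨i, hi, hle.trans ?_⟩
  rw [Finset.mul_sum, Finset.mul_sum, ← Finset.sum_add_distrib]
  refine Finset.sum_le_sum fun i hi => ?_
  -- The coefficient `3 / 2` must stay below `2` for the far case of
  -- `exists_mem_supportGrid_sum_le`.
  have h1 : dist c (q i) ^ 2 ≤ 3 / 2 * dist (p i) c ^ 2 + 3 * dist (p i) (q i) ^ 2 := by
    nlinarith [dist_triangle_left c (q i) (p i),
      sq_nonneg (dist (p i) c - 2 * dist (p i) (q i)), dist_nonneg (x := c) (y := q i)]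
  nlinarith [mul_le_mul_of_nonneg_left h1 (hμ i hi)]

/-- The support grid contains a point that serves the masses `μ i` at `p i` almost as well as any
other location, up to the cost of moving the masses to their anchors. -/
lemma exists_mem_supportGrid_sum_le {ε ε₂ Δ : ℝ} (hε : 0 < ε) (hε1 : ε ≤ 1) (hε₂ : ε₂ = ε / 16)
    (hμ : ∀ i ∈ I, 0 ≤ μ i) (hM : 0 < ∑ i ∈ I, μ i) {p q : ι → Pt d}
    (hsep : ∀ i ∈ I, ∀ j ∈ I, p i ≠ p j → 1 ≤ dist (p i) (p j) ∧ dist (p i) (p j) ≤ Δ)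
    {A : Set (Pt d)} (hq : ∀ i ∈ I, q i ∈ A) :
    ∃ x ∈ supportGrid ε₂ Δ A, ∀ y, ∑ i ∈ I, μ i * dist (p i) x ^ 2 ≤
      (1 + ε / 4) * (∑ i ∈ I, μ i * dist (p i) y ^ 2) +
        12 * ∑ i ∈ I, μ i * dist (p i) (q i) ^ 2 := by
  set c := centroid I μ p with hc
  set M := ∑ i ∈ I, μ i with hMdef
  set D := ∑ i ∈ I, μ i * dist (p i) c ^ 2 with hDdef
  set E := ∑ i ∈ I, μ i * dist (p i) (q i) ^ 2 with hEdef
  have hD0 : 0 ≤ D := Finset.sum_nonneg fun i hi => mul_nonneg (hμ i hi) (sq_nonneg _)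
  have hE0 : 0 ≤ E := Finset.sum_nonneg fun i hi => mul_nonneg (hμ i hi) (sq_nonneg _)
  suffices h : ∃ x ∈ supportGrid ε₂ Δ A, M * dist c x ^ 2 ≤ ε / 4 * D + 12 * E by
    obtain ⟨x, hx, hle⟩ := h
    refine ⟨x, hx, fun y => ?_⟩
    rw [sum_mul_dist_sq_eq hM p x, sum_mul_dist_sq_eq hM p y]
    have : 0 ≤ M * dist c y ^ 2 := by positivity
    nlinarith
  -- This threshold turns `32 τ` into `4 ε₂ = ε / 4`.
  by_cases hsmall : D < ε₂ / 8 * M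
  · obtain ⟨i, hi, hle⟩ := exists_anchor_near_centroid (q := q) hμ hM
      (fun i hi j hj h => (hsep i hi j hj h).1) (by linarith) hsmall
    refine ⟨q i, self_mem_supportGrid (hq i hi), hle.trans_eq ?_⟩
    rw [hε₂]; ring
  rw [not_lt] at hsmall
  obtain ⟨i, hi, hle⟩ := exists_anchor_dist_centroid_le hμ hM p q c
  rw [← hMdef, ← hDdef, ← hEdef] at hle
  by_cases hfar : dist c (q i) ≤ 2 ^ ⌈Real.logb 2 Δ⌉₊
  · obtain ⟨x, hx, hxd⟩ := exists_mem_supportGrid_dist_le (ε₂ := ε₂) (by linarith) (hq i hi) hfar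
    refine ⟨x, hx, ?_⟩
    have h1 : M * dist c x ^ 2 ≤ ε₂ ^ 2 * (3 / 2 * D + 3 * E + M / 4) := by
      nlinarith [mul_le_mul_of_nonneg_left hxd hM.le,
        mul_le_mul_of_nonneg_left hle (sq_nonneg ε₂)]
    -- Large variance absorbs the additive grid error.
    have h2 : ε₂ ^ 2 * (M / 4) ≤ 2 * ε₂ * D := by
      nlinarith [mul_le_mul_of_nonneg_left hsmall (by linarith : 0 ≤ 2 * ε₂)]
    have h3 : ε₂ ^ 2 ≤ ε₂ / 16 := by rw [hε₂]; nlinarith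
    have h4 := mul_le_mul_of_nonneg_right h3 hD0
    have h5 := mul_le_mul_of_nonneg_right h3 hE0
    nlinarith [mul_nonneg hε.le hD0, mul_le_mul_of_nonneg_right hε1 hE0]
  -- The anchor is farther than `Δ`, so `2 D ≤ M Δ² ≤ 3/2 D + 3 E`. Hence `D ≤ 6 E`, and the anchor
  -- itself costs at most `9 E + 3 E`: the origin of `12`.
  · refine ⟨q i, self_mem_supportGrid (hq i hi), ?_⟩
    rw [not_le] at hfar
    have hΔ : 1 ≤ Δ := by
      -- If `Δ < 1`, all points coincide and zero variance contradicts `hsmall`.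
      by_contra hΔ
      have h1 := two_mul_variance_le hμ hM (p := p) (Δ := 0) fun i hi j hj => by
        by_contra h
        have hne : p i ≠ p j := fun h' => h (by rw [h', dist_self])
        have := hsep i hi j hj hne
        linarith
      have : 0 < ε₂ / 8 * M := mul_pos (by linarith) hM
      linarith
    have h1 := two_mul_variance_le hμ hM (p := p) (Δ := Δ) fun i hi j hj => by
      by_cases h : p i = p j
      · rw [h, dist_self]; linarith
      · exact (hsep i hi j hj h).2
    have h2 : Δ ≤ dist c (q i) := (le_two_pow_ceil_logb (by linarith)).trans hfar.le
    have h3 : Δ ^ 2 ≤ dist c (q i) ^ 2 := by gcongr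
    have h4 := mul_le_mul_of_nonneg_left h3 hM.le
    have h5 := mul_nonneg hε.le hD0
    rw [← hc, ← hMdef, ← hDdef] at h1
    linarith

end Weighted

/-! ### The candidate on the grid and the theorem. -/

variable {m : ℕ}

lemma minWeight_le (P : Fin m → WSet d) {j : Fin m} {p : Pt d} (hp : p ∈ (P j).support) :
    minWeight P ≤ P j p := by
  refine csInf_le ⟨0, ?_⟩ ⟨j, p, hp, rfl⟩
  rintro _ ⟨j, p, -, rfl⟩
  positivity

lemma le_minWeight {P : Fin m → WSet d} {b : ℝ} (hne : ∃ j, ((P j).support).Nonempty)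
    (hb : ∀ j, ∀ p ∈ (P j).support, b ≤ P j p) : b ≤ minWeight P := by
  obtain ⟨j, p, hp⟩ := hne
  refine le_csInf ⟨_, j, p, hp, rfl⟩ ?_
  rintro _ ⟨j, p, hp, rfl⟩
  exact hb j p hp

lemma cost_le_cost_iff {d' : ℕ} (hm : 1 ≤ m) {z z' : ℝ} {P : Fin m → WSet d} {S : WSet d}
    {P' : Fin m → WSet d'} {S' : WSet d'} :
    cost z P S ≤ cost z' P' S' ↔
      ∑ j, wassOut z (P j) S ^ 2 ≤ ∑ j, wassOut z' (P' j) S' ^ 2 := by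
  have : (0 : ℝ) < m := by exact_mod_cast hm
  exact mul_le_mul_iff_of_pos_left (by positivity)

/-- Given plans to a weighted set `S`, the points of `S` can be moved into the support grid at a
small loss. -/
lemma exists_supportGrid_candidate {ε ε₂ Δ z : ℝ} (hm : 1 ≤ m) (hε : 0 < ε) (hε1 : ε ≤ 1)
    (hε₂ : ε₂ = ε / 16)
    {P : Fin m → WSet d} {S : WSet d}
    (hS : ∀ j, total S = total (P j) - z)
    (hsep : ∀ i j, ∀ p ∈ (P i).support, ∀ q ∈ (P j).support, p ≠ q →
      1 ≤ dist p q ∧ dist p q ≤ Δ)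
    {g : Fin m → Pt d → Pt d} {A : Set (Pt d)} (hg : ∀ j, ∀ p ∈ (P j).support, g j p ∈ A)
    {f : Fin m → Pt d → Pt d → ℝ} (hf : ∀ j, IsPlan (P j) S (f j)) :
    ∃ S' : WSet d, total S' = total S ∧ ↑S'.support ⊆ supportGrid ε₂ Δ A ∧
      ∑ j, wassOut z (P j) S' ^ 2 ≤
        (1 + ε / 4) * (∑ j, flowCost (P j) S (f j)) + 12 * ∑ j, moveCost (P j) (g j) := by
  classical
  have hloc : ∀ s ∈ S.support, ∃ x ∈ supportGrid ε₂ Δ A,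
      ∑ j, ∑ p ∈ (P j).support, f j p s * dist p x ^ 2 ≤
        (1 + ε / 4) * (∑ j, ∑ p ∈ (P j).support, f j p s * dist p s ^ 2) +
          12 * ∑ j, ∑ p ∈ (P j).support, f j p s * dist p (g j p) ^ 2 := by
    intro s hs
    have hs0 : (0 : ℝ) < S s := by
      exact_mod_cast pos_iff_ne_zero.2 (Finsupp.mem_support_iff.1 hs)
    have hm0 : (0 : ℝ) < m := by exact_mod_cast hm
    -- The masses sent to `s` by all inputs are pooled; indexing by pairs keeps equal points of
    -- different inputs apart.
    obtain ⟨x, hx, hle⟩ := exists_mem_supportGrid_sum_le (ι := Σ _ : Fin m, Pt d)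
      (I := Finset.univ.sigma fun j => (P j).support) (μ := fun i => f i.1 i.2 s)
      (p := fun i => i.2) (q := fun i => g i.1 i.2) (Δ := Δ) (A := A) hε hε1 hε₂
      (fun i hi => (hf i.1).nonneg i.2 (Finset.mem_sigma.1 hi).2 s hs)
      (by
        rw [Finset.sum_sigma]
        simp only [(hf _).into s hs, Finset.sum_const, Finset.card_univ, Fintype.card_fin,
          nsmul_eq_mul]
        positivity)
      (fun i hi j hj h =>
        hsep i.1 j.1 i.2 (Finset.mem_sigma.1 hi).2 j.2 (Finset.mem_sigma.1 hj).2 h)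
      (fun i hi => hg i.1 i.2 (Finset.mem_sigma.1 hi).2)
    refine ⟨x, hx, ?_⟩
    have := hle s
    simpa only [Finset.sum_sigma] using this
  choose! x hx hle using hloc
  refine ⟨S.mapDomain x, total_mapDomain S x, ?_, ?_⟩
  · rw [support_mapDomain]
    intro y hy
    obtain ⟨s, hs, rfl⟩ := Finset.mem_image.1 (Finset.mem_coe.1 hy)
    exact hx s hs
  have h1 : ∀ j, wassOut z (P j) (S.mapDomain x) ^ 2 ≤
      ∑ s ∈ S.support, ∑ p ∈ (P j).support, f j p s * dist p (x s) ^ 2 := by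
    intro j
    obtain ⟨f', hf', heq⟩ := (hf j).push_target x
    rw [Finset.sum_comm, ← heq]
    exact wassOut_sq_le_flowCost (by rw [total_mapDomain]; exact hS j) hf'
  have h2 : ∀ j, ∑ s ∈ S.support, ∑ p ∈ (P j).support, f j p s * dist p (g j p) ^ 2 ≤
      moveCost (P j) (g j) := by
    intro j
    rw [Finset.sum_comm]
    exact (hf j).sum_mul_le fun p => sq_nonneg _
  calc ∑ j, wassOut z (P j) (S.mapDomain x) ^ 2
      ≤ ∑ j, ∑ s ∈ S.support, ∑ p ∈ (P j).support, f j p s * dist p (x s) ^ 2 :=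
        Finset.sum_le_sum fun j _ => h1 j
    _ = ∑ s ∈ S.support, ∑ j, ∑ p ∈ (P j).support, f j p s * dist p (x s) ^ 2 :=
        Finset.sum_comm
    _ ≤ ∑ s ∈ S.support, ((1 + ε / 4) * (∑ j, ∑ p ∈ (P j).support, f j p s * dist p s ^ 2) +
          12 * ∑ j, ∑ p ∈ (P j).support, f j p s * dist p (g j p) ^ 2) :=
        Finset.sum_le_sum hle
    _ = (1 + ε / 4) * (∑ j, flowCost (P j) S (f j)) +
          12 * ∑ j, ∑ s ∈ S.support, ∑ p ∈ (P j).support, f j p s * dist p (g j p) ^ 2 := by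
        rw [Finset.sum_add_distrib, ← Finset.mul_sum, ← Finset.mul_sum, Finset.sum_comm,
          Finset.sum_comm (s := S.support)]
        congr 2
        exact Finset.sum_congr rfl fun j _ => Finset.sum_comm
    _ ≤ _ := by
        have := Finset.sum_le_sum fun j (_ : j ∈ Finset.univ) => h2 j
        linarith

end WB

end

theorem theorem3 {d m k lam : ℕ} (hm : 1 ≤ m) (hk : 1 ≤ k) (hlam : 1 ≤ lam)
    {n z α ε ε₁ ε₂ Δ : ℝ} (hz : 0 ≤ z) (hzn : z < n) (hα : 1 ≤ α)
    (hε : 0 < ε) (hε1 : ε ≤ 1) (hε₁ : ε₁ = ε / 16) (hε₂ : ε₂ = ε / 16)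
    -- the instance, normalised
    (P : Fin m → WB.WSet d) (hP : ∀ j, WB.total (P j) = n)
    (hw : ∀ j, ∀ p ∈ (P j).support, 1 / n ≤ (P j p : ℝ))
    (hΔ : ∀ i j, ∀ p ∈ (P i).support, ∀ q ∈ (P j).support, p ≠ q →
      1 ≤ dist p q ∧ dist p q ≤ Δ)
    -- the centres returned by the clustering algorithm
    (T : Fin m → Fin (lam * (k + ⌈z / WB.minWeight P⌉₊)) → WB.Pt d)
    (hT : ∀ j, WB.kmeansCost (P j) (T j) ≤
      α * WB.kmeansOpt (k + ⌈z / WB.minWeight P⌉₊) (P j))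
    -- the anchor points
    (That : Fin m → WB.WSet d) (A : Fin m → Set (WB.Pt d))
    (hA : ∀ j, WB.IsAnchorSet α ε₁ n (P j) (T j) (That j) (A j))
    -- the solution of the fixed-support problem, for the input or for its weighted anchor sets
    (G : WB.WSet d)
    (hG : WB.IsOptFixedSupport n z (WB.supportGrid ε₂ Δ (⋃ j, A j)) P G ∨
      WB.IsOptFixedSupport n z (WB.supportGrid ε₂ Δ (⋃ j, A j)) That G)
    (Sopt : WB.WSet d) (hS : WB.IsOptSparse n z k P Sopt) :
    WB.cost z P G ≤ (1 + ε) * WB.cost z P Sopt := by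
  have hn : 0 < n := by linarith
  have hm0 : (0 : ℝ) < m := by exact_mod_cast hm
  have hε₁0 : 0 < ε₁ := by linarith
  have hα0 : 0 < α := by linarith
  obtain ⟨⟨hStot, hScard⟩, -⟩ := hS
  choose σ g hσ hg hThat hAsub _ using hA
  have hwmin : 1 / n ≤ WB.minWeight P := by
    refine WB.le_minWeight ⟨⟨0, hm⟩, ?_⟩ hw
    by_contra h
    rw [Finset.not_nonempty_iff_eq_empty] at h
    have := hP ⟨0, hm⟩
    simp [WB.total, h] at this
    linarith
  have hwpos : 0 < WB.minWeight P := lt_of_lt_of_le (by positivity) hwmin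
  have hzw : z ≤ ⌈z / WB.minWeight P⌉₊ * WB.minWeight P :=
    (div_le_iff₀ hwpos).1 (Nat.le_ceil _)
  have hmove : ∀ j f, WB.IsPlan (P j) Sopt f →
      WB.moveCost (P j) (g j) ≤ 5 / 4 * ε₁ ^ 2 * WB.flowCost (P j) Sopt f := by
    intro j f hf
    have h1 := WB.moveCost_anchor_le hα hε₁0 hn (hP j) (hw j) (hσ j) (hg j)
    have h2 := WB.kmeansOpt_le_flowCost hf (by rw [hStot, hP j]) (by rw [hStot]; linarith)
      hScard (fun p hp => WB.minWeight_le P hp) hzw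
    -- The clustering factor `α` cancels the `1 / α` won from the side length of the layer grids.
    calc WB.moveCost (P j) (g j)
        ≤ ε₁ ^ 2 / α * (5 / 4 * (α * WB.flowCost (P j) Sopt f)) := by
          refine h1.trans ?_
          have := (hT j).trans (mul_le_mul_of_nonneg_left h2 hα0.le)
          gcongr
      _ = _ := by field_simp
  refine le_of_forall_pos_le_add fun η hη => ?_
  choose f hf hfle using fun j => WB.exists_isPlan_flowCost_le (P := P j) (S := Sopt) (z := z)
    (η := η / (1 + ε)) hz (by rw [hP j]; exact hzn) (by rw [hStot, hP j]) (by positivity)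
  obtain ⟨S', hS'tot, hS'sub, hS'le⟩ := WB.exists_supportGrid_candidate (Δ := Δ) (z := z)
    (A := ⋃ j, A j) hm hε hε1 hε₂ (fun j => by rw [hStot, hP j]) hΔ (g := g)
    (fun j p hp => Set.mem_iUnion.2 ⟨j, hAsub j (by
      rw [hThat j]; exact WB.mem_support_mapDomain (g j) hp)⟩) hf
  rw [hStot] at hS'tot
  set F := ∑ j, WB.flowCost (P j) Sopt (f j) with hF
  set B := ∑ j, WB.moveCost (P j) (g j) with hB
  have hF0 : 0 ≤ F := Finset.sum_nonneg fun j _ => (hf j).flowCost_nonneg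
  have hBF : B ≤ 5 / 4 * ε₁ ^ 2 * F := by
    rw [hF, Finset.mul_sum]
    exact Finset.sum_le_sum fun j _ => hmove j _ (hf j)
  -- `12 · 5/4 · ε²/256 ≤ 15/256 · ε`, less than the gap between `ε / 4` and `ε / 3`.
  have hcand : ∑ j, WB.wassOut z (P j) S' ^ 2 ≤ (1 + ε / 3) * F := by
    have h1 : ε ^ 2 ≤ ε := by nlinarith
    have h2 := mul_le_mul_of_nonneg_right h1 hF0
    rw [hε₁] at hBF
    nlinarith [mul_nonneg hε.le hF0]
  suffices hmain : ∑ j, WB.wassOut z (P j) G ^ 2 ≤ (1 + ε) * F by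
    have h1 : F ≤ ∑ j, WB.wassOut z (P j) Sopt ^ 2 + m * (η / (1 + ε)) := by
      have := Finset.sum_le_sum fun j (_ : j ∈ Finset.univ) => hfle j
      simpa [Finset.sum_add_distrib] using this
    calc WB.cost z P G ≤ 1 / m * ((1 + ε) * F) :=
          mul_le_mul_of_nonneg_left hmain (by positivity)
      _ ≤ 1 / m * ((1 + ε) * (∑ j, WB.wassOut z (P j) Sopt ^ 2 + m * (η / (1 + ε)))) := by
          gcongr
      _ = (1 + ε) * WB.cost z P Sopt + η := by
          rw [WB.cost]; field_simp
  rcases hG with ⟨-, hopt⟩ | ⟨⟨hGtot, -⟩, hopt⟩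
  · have h1 := (WB.cost_le_cost_iff hm).1 (hopt S' hS'tot hS'sub)
    nlinarith [mul_nonneg hε.le hF0]
  · have h1 := (WB.cost_le_cost_iff hm).1 (hopt S' hS'tot hS'sub)
    -- With `t = ε / 8`, the factor `1 + 1/t` on `B = O(ε² F)` leaves only `O(ε F)`.
    have ht : 0 < ε / 8 := by positivity
    have h2 : ∑ j, WB.wassOut z (P j) G ^ 2 ≤
        (1 + ε / 8) * (∑ j, WB.wassOut z (That j) G ^ 2) + (1 + 1 / (ε / 8)) * B := by
      rw [hB, Finset.mul_sum, Finset.mul_sum, ← Finset.sum_add_distrib]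
      refine Finset.sum_le_sum fun j _ => ?_
      rw [hThat j]
      exact WB.wassOut_sq_le_mapDomain hz (by rw [hP j]; exact hzn) (by rw [hGtot, hP j]) _ ht
    have h3 : ∑ j, WB.wassOut z (That j) S' ^ 2 ≤
        (1 + ε / 8) * (∑ j, WB.wassOut z (P j) S' ^ 2) + (1 + 1 / (ε / 8)) * B := by
      rw [hB, Finset.mul_sum, Finset.mul_sum, ← Finset.sum_add_distrib]
      refine Finset.sum_le_sum fun j _ => ?_
      rw [hThat j]
      exact WB.wassOut_mapDomain_sq_le hz (by rw [hP j]; exact hzn) (by rw [hS'tot, hP j]) _ ht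
    have h4 : (1 + 1 / (ε / 8)) * B ≤ 45 / 1024 * ε * F := by
      calc (1 + 1 / (ε / 8)) * B ≤ (1 + 1 / (ε / 8)) * (5 / 4 * ε₁ ^ 2 * F) := by gcongr
        _ = 5 / 1024 * (ε + 8) * ε * F := by rw [hε₁]; field_simp; ring
        _ ≤ 45 / 1024 * ε * F := by
          have := mul_nonneg hε.le hF0
          nlinarith
    set C := (1 + 1 / (ε / 8)) * B
    have h5 : ∑ j, WB.wassOut z (That j) G ^ 2 ≤
        (1 + ε / 8) * ((1 + ε / 3) * F) + 45 / 1024 * ε * F := by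
      have := mul_le_mul_of_nonneg_left hcand (by positivity : 0 ≤ 1 + ε / 8)
      linarith
    have h6 := mul_le_mul_of_nonneg_left h5 (by positivity : 0 ≤ 1 + ε / 8)
    have h7 : (1 + ε / 8) * ((1 + ε / 8) * (1 + ε / 3) + 45 / 1024 * ε) + 45 / 1024 * ε ≤
        1 + ε := by nlinarith [pow_pos hε 2, pow_pos hε 3, mul_nonneg hε.le (sub_nonneg.2 hε1),
          mul_nonneg (sq_nonneg ε) (sub_nonneg.2 hε1)]
    have h8 := mul_le_mul_of_nonneg_right h7 hF0
    linarith
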